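/- Let $I$ be a countable set (finite, infinite or empty). For a standard probability space $(X,\mu)$ (a standard Borel space with a probability measure, atoms allowed), let $\operatorname{Aut}_{\mathrm{mp}}(X,\mu)$ be the group of measure preserving automorphisms of $(X,\mu)$, identified when they coincide almost everywhere, with the topology in which $T_n \to T$ if and only if $\mu(T_n^{-1}(A) \,\triangle\, T^{-1}(A)) \to 0$ for every measurable $A \subset X$. A measure preserving action $\Lambda \curvearrowright (X,\mu)$ is a homomorphism $\Lambda \to \operatorname{Aut}_{\mathrm{mp}}(X,\mu)$; it is ergodic if every measurable set that is invariant up to null sets has measure $0$ or $1$. A Polish group $G$ is called a centralizer group if there exists an ergodic measure preserving action of a countable group $\Lambda$ on a standard probability space $(X,\mu)$ such that $G$ is isomorphic, as a topological group, with the centralizer of (the image of) $\Lambda$ inside $\operatorname{Aut}_{\mathrm{mp}}(X,\mu)$. (1) If $(G_i)_{i \in I}$ is a family of centralizer groups, then the product $\prod_{i\in I} G_i$, with the product topology, is a centralizer group. (2) More precisely, let $\Lambda_i \curvearrowright (X_i,\mu_i)$, $i \in I$, be ergodic measure preserving actions of countable groups on standard probability spaces, and let $e_i$ be an isomorphism of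 topological groups from a topological group $G_i$ onto the centralizer of $\Lambda_i$ in $\operatorname{Aut}_{\mathrm{mp}}(X_i,\mu_i)$. Let $(X,\mu) = \prod_{i \in I} (X_i,\mu_i)$, and let $\Gamma < \operatorname{Aut}_{\mathrm{mp}}(X,\mu)$ be the subgroup generated by all the groups $\Lambda_i$, where $\Lambda_i$ acts in the $i$-th coordinate and trivially in the others. Then $X$ is a standard Borel space, $\Gamma$ is countable and acts ergodically on $(X,\mu)$, and $$(g_i)_{i \in I} \mapsto \prod_{i\in I} e_i(g_i), \qquad \Bigl(\prod_{i \in I} e_i(g_i)\Bigr)(x) = (e_i(g_i)(x_i))_{i \in I},$$ is an isomorphism of topological groups from $\prod_{i \in I} G_i$ onto the centralizer of $\Gamma$ inside $\operatorname{Aut}_{\mathrm{mp}}(X,\mu)$. -/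

import Mathlib

open MeasureTheory

/-- Measure preserving measurable bijections of `(X, μ)`, before identification modulo null sets. -/
abbrev PreAutMP {X : Type*} [MeasurableSpace X] (μ : Measure X) :=
  {f : X ≃ᵐ X // MeasurePreserving f μ μ}

/-- Two automorphisms are identified when they coincide almost everywhere. -/
instance PreAutMP.setoid {X : Type*} [MeasurableSpace X] (μ : Measure X) :
    Setoid (PreAutMP μ) where
  r f g := (f.1 : X → X) =ᵐ[μ] g.1
  iseqv := ⟨fun _ => Filter.EventuallyEq.rfl, fun h => h.symm, fun h k => h.trans k⟩

/-- `Aut_mp(X, μ)`: the measure preserving automorphisms of `(X, μ)`, identified when they coincide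
almost everywhere. (On a standard Borel space, every measurable isomorphism between conull
measurable subsets agrees almost everywhere with a measurable bijection of the whole space.) -/
def AutMP {X : Type*} [MeasurableSpace X] (μ : Measure X) : Type _ :=
  Quotient (PreAutMP.setoid μ)

namespace AutMP

section Basic

variable {X : Type*} [MeasurableSpace X] {μ : Measure X}

/-- The class of a measure preserving measurable bijection. -/
def mk (f : X ≃ᵐ X) (hf : MeasurePreserving f μ μ) : AutMP μ :=
  Quotient.mk (PreAutMP.setoid μ) ⟨f, hf⟩

/-- A representative; it is well defined up to almost everywhere equality. -/
noncomputable def rep (T : AutMP μ) : X ≃ᵐ X :=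
  (Quotient.out T).1

theorem measurePreserving_rep (T : AutMP μ) : MeasurePreserving T.rep μ μ :=
  (Quotient.out T).2

theorem mk_rep (T : AutMP μ) : mk T.rep T.measurePreserving_rep = T :=
  Quotient.out_eq T

theorem mk_eq_mk {f g : X ≃ᵐ X} {hf : MeasurePreserving f μ μ} {hg : MeasurePreserving g μ μ} :
    mk f hf = mk g hg ↔ (f : X → X) =ᵐ[μ] g :=
  ⟨fun h => Quotient.exact h, fun h => Quotient.sound h⟩

theorem rep_mk (f : X ≃ᵐ X) (hf : MeasurePreserving f μ μ) :
    ((mk f hf).rep : X → X) =ᵐ[μ] f :=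
  mk_eq_mk.1 (mk_rep (mk f hf))

theorem symm_congr {f g : X ≃ᵐ X} (hg : MeasurePreserving g μ μ)
    (h : (f : X → X) =ᵐ[μ] g) : (f.symm : X → X) =ᵐ[μ] g.symm := by
  have h' := (hg.symm g).quasiMeasurePreserving.ae h
  filter_upwards [h'] with x hx
  rw [MeasurableEquiv.apply_symm_apply] at hx
  rw [← hx, MeasurableEquiv.symm_apply_apply, hx]

/-- The group structure: the product `S * T` is the class of the composition `S ∘ T`. -/
instance instGroup : Group (AutMP μ) where
  mul := Quotient.map₂ (fun f g => ⟨g.1.trans f.1, f.2.comp g.2⟩) (by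
    intro f f' hf g g' hg
    exact (g.2.quasiMeasurePreserving.ae_eq_comp hf).trans (hg.fun_comp f'.1))
  one := mk (MeasurableEquiv.refl X) (MeasurePreserving.id μ)
  inv := Quotient.map (fun f => ⟨f.1.symm, f.2.symm f.1⟩) (by
    intro f g h
    exact symm_congr g.2 h)
  mul_assoc := by
    rintro ⟨f⟩ ⟨g⟩ ⟨h⟩
    rfl
  one_mul := by
    rintro ⟨f⟩
    rfl
  mul_one := by
    rintro ⟨f⟩
    rfl
  inv_mul_cancel := by
    rintro ⟨f⟩
    exact mk_eq_mk.2 (Filter.Eventually.of_forall fun x => f.1.symm_apply_apply x)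

theorem measurePreserving_trans {f g : X ≃ᵐ X} (hf : MeasurePreserving f μ μ)
    (hg : MeasurePreserving g μ μ) : MeasurePreserving (g.trans f) μ μ :=
  hf.comp hg

theorem mk_mul_mk (f g : X ≃ᵐ X) (hf : MeasurePreserving f μ μ) (hg : MeasurePreserving g μ μ) :
    mk f hf * mk g hg = mk (g.trans f) (measurePreserving_trans hf hg) :=
  rfl

theorem rep_mul (S T : AutMP μ) : ((S * T).rep : X → X) =ᵐ[μ] S.rep ∘ T.rep := by
  have h : S * T = mk (T.rep.trans S.rep)
      (measurePreserving_trans S.measurePreserving_rep T.measurePreserving_rep) := by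
    rw [← mk_mul_mk _ _ S.measurePreserving_rep T.measurePreserving_rep, mk_rep, mk_rep]
  rw [h]
  exact rep_mk _ _

/-- The inverse image of a measurable set, as a point of the space of measurable sets with the
pseudometric `μ (A ∆ B)`. -/
noncomputable def preimage (T : AutMP μ) (A : MeasuredSets μ) : MeasuredSets μ :=
  ⟨T.rep ⁻¹' A.1, T.rep.measurable A.2⟩

/-- The usual (weak) topology of `Aut_mp(X, μ)`: the coarsest one for which `T ↦ T⁻¹(A)` is
continuous into the measure algebra for every measurable `A`. Thus `Tₙ → T` if and only if
`μ (Tₙ⁻¹(A) ∆ T⁻¹(A)) → 0` for all measurable `A`; since `μ` is preserved, this is the same as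
`μ (Tₙ(A) ∆ T(A)) → 0` for all measurable `A`. -/
noncomputable instance instTopologicalSpace : TopologicalSpace (AutMP μ) :=
  ⨅ A : MeasuredSets μ, TopologicalSpace.induced (fun T : AutMP μ => T.preimage A) inferInstance

/-- A measure preserving action `Λ ↷ (X, μ)`, i.e. a homomorphism `Λ → Aut_mp(X, μ)`, is ergodic if
every almost invariant measurable set is null or conull. -/
def IsErgodicAction {Λ : Type*} [Group Λ] (ρ : Λ →* AutMP μ) : Prop :=
  ∀ s : Set X, MeasurableSet s → (∀ l : Λ, (ρ l).rep ⁻¹' s =ᵐ[μ] s) → μ s = 0 ∨ μ sᶜ = 0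

end Basic

section Product

variable {I : Type*} {X : I → Type*} [∀ i, MeasurableSpace (X i)]
  (μ : ∀ i, Measure (X i)) [∀ i, IsProbabilityMeasure (μ i)]

theorem measurePreserving_piCongrRight (f : ∀ i, X i ≃ᵐ X i)
    (hf : ∀ i, MeasurePreserving (f i) (μ i) (μ i)) :
    MeasurePreserving (MeasurableEquiv.piCongrRight f)
      (Measure.infinitePi μ) (Measure.infinitePi μ) := by
  refine ⟨(MeasurableEquiv.piCongrRight f).measurable, ?_⟩
  have h := Measure.infinitePi_map_pi μ (f := fun i => (f i : X i → X i))
    (fun i => (f i).measurable)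
  simp only [(hf _).map_eq] at h
  exact h

theorem piCongrRight_congr [Countable I] {f g : ∀ i, X i ≃ᵐ X i}
    (h : ∀ i, (f i : X i → X i) =ᵐ[μ i] g i) :
    (MeasurableEquiv.piCongrRight f : (∀ i, X i) → ∀ i, X i) =ᵐ[Measure.infinitePi μ]
      MeasurableEquiv.piCongrRight g := by
  have h' : ∀ᵐ x ∂(Measure.infinitePi μ), ∀ i, f i (x i) = g i (x i) :=
    ae_all_iff.2 fun i =>
      (measurePreserving_eval_infinitePi μ i).quasiMeasurePreserving.ae (h i)
  filter_upwards [h'] with x hx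
  funext i
  exact hx i

/-- The product automorphism `∏ᵢ Tᵢ : (xᵢ)ᵢ ↦ (Tᵢ xᵢ)ᵢ` of the product probability space, as a
group homomorphism `∏ᵢ Aut_mp(Xᵢ, μᵢ) → Aut_mp(∏ᵢ (Xᵢ, μᵢ))`. -/
noncomputable def prodHom [Countable I] :
    (∀ i, AutMP (μ i)) →* AutMP (Measure.infinitePi μ) :=
  MonoidHom.mk'
    (fun T => mk (MeasurableEquiv.piCongrRight fun i => (T i).rep)
      (measurePreserving_piCongrRight μ _ fun i => (T i).measurePreserving_rep))
    (by
      intro S T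
      rw [mk_mul_mk, mk_eq_mk]
      exact piCongrRight_congr μ (g := fun i => (T i).rep.trans (S i).rep)
        fun i => rep_mul (S i) (T i))

open Classical in
/-- `Aut_mp(Xᵢ, μᵢ)` acting in the `i`-th coordinate of the product, and trivially in the others. -/
noncomputable def coordHom [Countable I] (i : I) :
    AutMP (μ i) →* AutMP (Measure.infinitePi μ) :=
  (prodHom μ).comp (MonoidHom.mulSingle (fun j => AutMP (μ j)) i)

/-- Given actions `Λᵢ ↷ (Xᵢ, μᵢ)`, the subgroup of `Aut_mp(∏ᵢ (Xᵢ, μᵢ))` generated by all the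
groups `Λᵢ`, where `Λᵢ` acts in the `i`-th coordinate. -/
noncomputable def coordSubgroup [Countable I] {Λ : I → Type*} [∀ i, Group (Λ i)]
    (ρ : ∀ i, Λ i →* AutMP (μ i)) : Subgroup (AutMP (Measure.infinitePi μ)) :=
  ⨆ i, ((coordHom μ i).comp (ρ i)).range

end Product

end AutMP

/-- A Polish group `G` is a centralizer group if there is an ergodic probability measure preserving
action of a countable group `Λ` on a standard probability space `(X, μ)` such that `G` is
isomorphic, as a topological group, with the centralizer of `Λ` inside `Aut_mp(X, μ)`.
(Every standard Borel space and every countable group has an isomorphic copy in `Type`.) -/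
def IsCentralizerGroup (G : Type*) [Group G] [TopologicalSpace G] : Prop :=
  IsTopologicalGroup G ∧ PolishSpace G ∧
    ∃ (X : Type) (_ : MeasurableSpace X) (_ : StandardBorelSpace X)
      (μ : Measure X) (_ : IsProbabilityMeasure μ)
      (Λ : Type) (_ : Group Λ) (_ : Countable Λ) (ρ : Λ →* AutMP μ),
      AutMP.IsErgodicAction ρ ∧ Nonempty (G ≃ₜ* Subgroup.centralizer (Set.range ρ))

/-!
An ergodic coordinate is independent of every set that is almost invariant in the direction of that
coordinate: the coordinate's law conditioned on such a set is absolutely continuous and invariant,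
so its density is constant. Hence a set invariant under the actions in the coordinates `J` is, up
to a null set, an event of the coordinates outside `J`. With `J` the whole index set this is
ergodicity of the group generated by the coordinate actions. If `T` commutes with this group, the
`i`-th coordinate of `T x` is invariant in all directions except the `i`-th, so it is a function of
`x i` alone; applied to `T` and `T⁻¹`, this writes `T` as a product of automorphisms. Finally, the
topologies are compared on the sets depending on one coordinate, which generate the product
σ-algebra.
-/

open ProbabilityTheory Filter
open scoped ENNReal

theorem countable_subgroup_closure {G : Type*} [Group G] {s : Set G} (hs : s.Countable) :
    Countable (Subgroup.closure s) := by
  have : Countable s := hs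
  have : Countable (FreeGroup s) := Quot.mk_surjective.countable
  rw [← Subtype.range_coe (s := s), ← FreeGroup.range_lift_eq_closure]
  exact (MonoidHom.rangeRestrict_surjective _).countable

/-- The product of isomorphisms of topological groups. -/
def piCongrRightContinuousMulEquiv {I : Type*} {G H : I → Type*} [∀ i, Mul (G i)]
    [∀ i, TopologicalSpace (G i)] [∀ i, Mul (H i)] [∀ i, TopologicalSpace (H i)]
    (e : ∀ i, G i ≃ₜ* H i) : (∀ i, G i) ≃ₜ* (∀ i, H i) where
  toMulEquiv := MulEquiv.piCongrRight fun i => (e i).toMulEquiv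
  continuous_toFun := continuous_pi fun i => (e i).continuous_toFun.comp (continuous_apply i)
  continuous_invFun := continuous_pi fun i => (e i).continuous_invFun.comp (continuous_apply i)

/-- Reindexing a product of topological groups along an equivalence. -/
def piReindexContinuousMulEquiv {I J : Type*} (G : I → Type*) [∀ i, Mul (G i)]
    [∀ i, TopologicalSpace (G i)] (e : J ≃ I) : (∀ i, G i) ≃ₜ* (∀ j, G (e j)) where
  toEquiv := (Equiv.piCongrLeft G e).symm
  map_mul' _ _ := rfl
  continuous_toFun := (Homeomorph.piCongrLeft (Y := G) e).symm.continuous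
  continuous_invFun := (Homeomorph.piCongrLeft (Y := G) e).continuous

theorem continuous_of_edist_eq {Z α β : Type*} [TopologicalSpace Z] [PseudoEMetricSpace α]
    [PseudoEMetricSpace β] {f : Z → α} {g : Z → β} (hf : Continuous f)
    (h : ∀ x y, edist (g x) (g y) = edist (f x) (f y)) : Continuous g := by
  refine continuous_iff_continuousAt.2 fun x => EMetric.tendsto_nhds.2 fun ε hε => ?_
  filter_upwards [EMetric.tendsto_nhds.1 (hf.tendsto x) ε hε] with y hy
  rwa [h]

section EventuallyMeasurable

variable {Ω Z : Type*} [MeasurableSpace Z] [StandardBorelSpace Z] [Nonempty Z]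

theorem exists_measurable_eventuallyEq_of_eventuallyMeasurable {m : MeasurableSpace Ω}
    {l : Filter Ω} [CountableInterFilter l] {f : Ω → Z} (hf : EventuallyMeasurable m l f) :
    ∃ g : Ω → Z, Measurable[m] g ∧ f =ᶠ[l] g := by
  classical
  -- Encode `Z` in `ℕ → Bool` by `ψ`, and replace `ψ ∘ f` by a measurable map one bit at a time.
  obtain ⟨ψ, hψ, hψ_inj⟩ :=
    MeasurableSpace.measurable_injection_nat_bool_of_countablySeparated Z
  obtain ⟨φ, hφ, hφψ⟩ :=
    (hψ.measurableEmbedding hψ_inj).exists_measurable_extend measurable_id fun _ => ‹Nonempty Z›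
  have hbit (n : ℕ) : MeasurableSet {z | ψ z n = true} :=
    (measurable_pi_apply n).comp hψ (measurableSet_singleton true)
  choose t ht hft using fun n => hf (hbit n)
  have hcode : Measurable[m] fun x n => decide (x ∈ t n) :=
    measurable_pi_lambda _ fun n => measurable_to_bool (by simpa [Set.preimage] using! ht n)
  refine ⟨fun x => φ fun n => decide (x ∈ t n), hφ.comp hcode, ?_⟩
  filter_upwards [eventually_countable_forall.2 fun n => (hft n).mem_iff] with x hx
  have hψx : (fun n => decide (x ∈ t n)) = ψ (f x) := by
    funext n
    rw [Bool.eq_iff_iff, decide_eq_true_iff, ← hx n]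
    rfl
  rw [hψx]
  exact (congrFun hφψ (f x)).symm

theorem exists_measurable_eventuallyEq_comp_of_eventuallyMeasurable {Y : Type*}
    [mY : MeasurableSpace Y] {l : Filter Ω} [CountableInterFilter l] {p : Ω → Y} {f : Ω → Z}
    (hf : EventuallyMeasurable (mY.comap p) l f) :
    ∃ g : Y → Z, Measurable g ∧ f =ᶠ[l] g ∘ p := by
  obtain ⟨_, hg, hfg⟩ := exists_measurable_eventuallyEq_of_eventuallyMeasurable hf
  obtain ⟨g, hg_meas, rfl⟩ := hg.exists_eq_measurable_comp
  exact ⟨g, hg_meas, hfg⟩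

end EventuallyMeasurable

theorem ae_eq_of_comp_ae_eq {Y X Z : Type*} [MeasurableSpace Y] [MeasurableSpace X]
    [MeasurableSpace Z] [MeasurableEq Z] {P : Measure Y} {μ : Measure X} {π : Y → X}
    (hπ : MeasurePreserving π P μ) {f g : X → Z} (hf : Measurable f) (hg : Measurable g)
    (h : f ∘ π =ᵐ[P] g ∘ π) : f =ᵐ[μ] g := by
  rw [← hπ.map_eq]
  exact (ae_map_iff hπ.aemeasurable (measurableSet_eq_fun hf hg)).2 h

section AEInverse

variable {Y : Type*} [MeasurableSpace Y] {μ : Measure Y}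

theorem exists_measurableSet_ae_mem_mapsTo {ι : Type*} [Countable ι] {f : ι → Y → Y}
    (hf : ∀ i, Measure.QuasiMeasurePreserving (f i) μ μ) {p : Y → Prop} (hp : ∀ᵐ y ∂μ, p y) :
    ∃ A, MeasurableSet A ∧ (∀ᵐ y ∂μ, y ∈ A) ∧ (∀ y ∈ A, p y) ∧ ∀ i, Set.MapsTo (f i) A A := by
  obtain ⟨A₀, hA₀, hA₀_meas, hA₀_sub⟩ := hp.exists_measurable_mem
  let A : ℕ → Set Y := Nat.rec A₀ fun _ B => B ∩ ⋂ i, f i ⁻¹' B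
  have hA_meas (n : ℕ) : MeasurableSet (A n) := by
    induction n with
    | zero => exact hA₀_meas
    | succ n ih => exact ih.inter (.iInter fun i => (hf i).measurable ih)
  have hA_ae (n : ℕ) : ∀ᵐ y ∂μ, y ∈ A n := by
    induction n with
    | zero => exact hA₀
    | succ n ih =>
      filter_upwards [ih, ae_all_iff.2 fun i => (hf i).ae ih] with y hy hfy
      exact ⟨hy, Set.mem_iInter.2 hfy⟩
  refine ⟨⋂ n, A n, .iInter hA_meas, ?_, fun y hy => hA₀_sub y (Set.mem_iInter.1 hy 0), ?_⟩
  · filter_upwards [ae_all_iff.2 hA_ae] with y hy using Set.mem_iInter.2 hy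
  · exact fun i y hy => Set.mem_iInter.2 fun n =>
      Set.mem_iInter.1 (Set.mem_iInter.1 hy (n + 1)).2 i

theorem exists_measurableEquiv_ae_eq {f g : Y → Y} (hf : Measure.QuasiMeasurePreserving f μ μ)
    (hg : Measure.QuasiMeasurePreserving g μ μ) (hgf : g ∘ f =ᵐ[μ] id) (hfg : f ∘ g =ᵐ[μ] id) :
    ∃ e : Y ≃ᵐ Y, e =ᵐ[μ] f := by
  classical
  obtain ⟨A, hA, hA_ae, hA_inv, hA_maps⟩ := exists_measurableSet_ae_mem_mapsTo
    (f := fun b : Bool => bif b then f else g) (Bool.forall_bool.2 ⟨hg, hf⟩) (hgf.and hfg)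
  have hAf : ∀ y ∈ A, f y ∈ A := hA_maps true
  have hAg : ∀ y ∈ A, g y ∈ A := hA_maps false
  have hgf' : ∀ y ∈ A, g (f y) = y := fun y hy => (hA_inv y hy).1
  have hfg' : ∀ y ∈ A, f (g y) = y := fun y hy => (hA_inv y hy).2
  refine ⟨⟨⟨A.piecewise f id, A.piecewise g id, fun y => ?_, fun y => ?_⟩,
    hf.measurable.piecewise hA measurable_id, hg.measurable.piecewise hA measurable_id⟩, ?_⟩
  · by_cases hy : y ∈ A <;> simp [hy, hAf, hgf']
  · by_cases hy : y ∈ A <;> simp [hy, hAg, hfg']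
  · filter_upwards [hA_ae] with y hy using Set.piecewise_eq_of_mem _ _ _ hy

end AEInverse

section Independence

variable {Ω : Type*} {m₁ m₂ 𝓘 mΩ : MeasurableSpace Ω} {P : Measure Ω}

theorem measure_ext_of_sup_eq {P Q : Measure Ω} [IsFiniteMeasure P] (hsup : m₁ ⊔ m₂ = mΩ)
    (h : ∀ s t, MeasurableSet[m₁] s → MeasurableSet[m₂] t → P (s ∩ t) = Q (s ∩ t)) : P = Q := by
  refine ext_of_generate_finite
    (Set.image2 (· ∩ ·) {s | MeasurableSet[m₁] s} {t | MeasurableSet[m₂] t}) ?_ ?_ ?_ ?_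
  · refine le_antisymm ?_ (MeasurableSpace.generateFrom_le ?_)
    · rw [← hsup]
      refine sup_le (fun s hs => ?_) fun t ht => ?_
      · exact .basic _ ⟨s, hs, Set.univ, .univ, s.inter_univ⟩
      · exact .basic _ ⟨Set.univ, .univ, t, ht, t.univ_inter⟩
    · rintro _ ⟨s, hs, t, ht, rfl⟩
      subst hsup
      exact .inter (le_sup_left (b := m₂) s hs) (le_sup_right (a := m₁) t ht)
  · rintro _ ⟨s, hs, t, ht, rfl⟩ _ ⟨s', hs', t', ht', rfl⟩ -
    exact ⟨s ∩ s', MeasurableSet.inter hs hs', t ∩ t', MeasurableSet.inter ht ht',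
      Set.inter_inter_inter_comm ..⟩
  · rintro _ ⟨s, hs, t, ht, rfl⟩
    exact h s t hs ht
  · simpa using h Set.univ Set.univ .univ .univ

theorem setLIntegral_inter_of_indep (h₁ : m₁ ≤ mΩ) (h₂ : m₂ ≤ mΩ) (hind : Indep m₁ m₂ P)
    {f : Ω → ℝ≥0∞} (hf : Measurable[m₁] f) {s t : Set Ω} (hs : MeasurableSet[m₁] s)
    (ht : MeasurableSet[m₂] t) : ∫⁻ ω in s ∩ t, f ω ∂P = (∫⁻ ω in s, f ω ∂P) * P t := by
  have key := lintegral_mul_eq_lintegral_mul_lintegral_of_independent_measurableSpace h₁ h₂ hind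
    (hf.indicator hs) (measurable_const.indicator ht : Measurable[m₂] (t.indicator 1))
  rw [lintegral_indicator (h₁ s hs), lintegral_indicator_one (h₂ t ht)] at key
  rw [← key, ← lintegral_indicator ((h₁ s hs).inter (h₂ t ht))]
  congr with ω
  by_cases hωs : ω ∈ s <;> by_cases hωt : ω ∈ t <;> simp [hωs, hωt]

theorem le_eventuallyMeasurableSpace_of_indep [IsFiniteMeasure P] (h₁ : m₁ ≤ 𝓘) (h𝓘 : 𝓘 ≤ mΩ)
    (hsup : m₁ ⊔ m₂ = mΩ) (hind : Indep 𝓘 m₂ P) :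
    𝓘 ≤ eventuallyMeasurableSpace m₁ (ae P) := by
  intro s hs
  have hm₁ : m₁ ≤ mΩ := h₁.trans h𝓘
  have hm₂ : m₂ ≤ mΩ := hsup ▸ le_sup_right
  have hind₁ : Indep m₁ m₂ P := indep_of_indep_of_le_left hind h₁
  let h : Ω → ℝ≥0∞ := P⁻[s.indicator 1|m₁]
  have hh : Measurable[m₁] h := measurable_condLExp m₁ P _
  -- Both `h` and the indicator of `s` are densities of `P.restrict s`, so `s = {h = 1}` a.e.
  have hdensity : P.restrict s = P.withDensity h := by
    refine measure_ext_of_sup_eq hsup fun b c hb hc => ?_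
    have hb' := hm₁ b hb
    have hc' := hm₂ c hc
    calc P.restrict s (b ∩ c)
      _ = P (s ∩ b ∩ c) := by
        rw [Measure.restrict_apply (hb'.inter hc'), Set.inter_comm, ← Set.inter_assoc]
      _ = P (s ∩ b) * P c := (Indep_iff _ _ _).1 hind _ _ (hs.inter (h₁ b hb)) hc
      _ = (∫⁻ ω in b, h ω ∂P) * P c := by
        rw [setLIntegral_condLExp hm₁ P _ hb, lintegral_indicator_one (h𝓘 s hs),
          Measure.restrict_apply (h𝓘 s hs)]
      _ = P.withDensity h (b ∩ c) := by
        rw [withDensity_apply _ (hb'.inter hc'), setLIntegral_inter_of_indep hm₁ hm₂ hind₁ hh hb hc]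
  rw [← withDensity_indicator_one (h𝓘 s hs), withDensity_eq_iff
    (measurable_one.indicator (h𝓘 s hs)).aemeasurable (hh.mono hm₁ le_rfl).aemeasurable
    (by rw [lintegral_indicator_one (h𝓘 s hs)]; exact measure_ne_top P s)] at hdensity
  refine ⟨h ⁻¹' {1}, hh (measurableSet_singleton 1), ?_⟩
  filter_upwards [hdensity] with ω hω
  refine propext (?_ : ω ∈ s ↔ h ω = 1)
  rw [← hω]
  by_cases hωs : ω ∈ s <;> simp [hωs]

theorem indep_biSup_of_indep {ι : Type*} {m 𝓘 : ι → MeasurableSpace Ω} {𝓙 : MeasurableSpace Ω}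
    {J : Set ι} [IsProbabilityMeasure P] (h𝓙 : 𝓙 ≤ mΩ) (hm : ∀ i ∈ J, m i ≤ mΩ)
    (h𝓙𝓘 : ∀ i ∈ J, 𝓙 ≤ 𝓘 i) (hm𝓘 : J.Pairwise fun i j => m i ≤ 𝓘 j)
    (hind : ∀ i ∈ J, Indep (𝓘 i) (m i) P) : Indep 𝓙 (⨆ i ∈ J, m i) P := by
  classical
  refine IndepSets.indep h𝓙 (iSup₂_le hm) 𝓙.isPiSystem_measurableSet
    (isPiSystem_piiUnionInter _ (fun i => (m i).isPiSystem_measurableSet) J)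
    (@MeasurableSpace.generateFrom_measurableSet _ 𝓙).symm
    (generateFrom_piiUnionInter_measurableSet m J).symm ?_
  rw [IndepSets_iff]
  rintro s _ hs ⟨F, hF, t, ht, rfl⟩
  induction F using Finset.induction_on with
  | empty => simp
  | insert i F hi ih =>
    obtain ⟨hiJ, hFJ⟩ := Set.insert_subset_iff.1 (Finset.coe_insert i F ▸ hF)
    have hti : MeasurableSet[m i] (t i) := ht i (F.mem_insert_self i)
    have htF : ∀ j ∈ F, MeasurableSet[m j] (t j) := fun j hj => ht j (Finset.mem_insert_of_mem hj)
    have htF_i : MeasurableSet[𝓘 i] (⋂ j ∈ F, t j) :=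
      F.measurableSet_biInter fun j hj =>
        hm𝓘 (hFJ hj) hiJ (ne_of_mem_of_not_mem hj hi) _ (htF j hj)
    have hmul := (Indep_iff _ _ _).1 (hind i hiJ)
    calc P (s ∩ ⋂ j ∈ insert i F, t j)
      _ = P (s ∩ (⋂ j ∈ F, t j) ∩ t i) := by
        rw [Finset.set_biInter_insert, Set.inter_comm (t i), Set.inter_assoc]
      _ = P s * P (⋂ j ∈ F, t j) * P (t i) := by
        rw [hmul _ _ ((h𝓙𝓘 i hiJ s hs).inter htF_i) hti, ih hFJ htF]
      _ = P s * P (⋂ j ∈ insert i F, t j) := by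
        rw [mul_assoc, ← hmul _ _ htF_i hti, Finset.set_biInter_insert, Set.inter_comm (t i)]

end Independence

namespace AutMP

section Basic

variable {X : Type*} [MeasurableSpace X] {μ : Measure X}

theorem rep_one : ((1 : AutMP μ).rep : X → X) =ᵐ[μ] id :=
  rep_mk (MeasurableEquiv.refl X) (MeasurePreserving.id μ)

theorem ext_rep {S T : AutMP μ} (h : (S.rep : X → X) =ᵐ[μ] T.rep) : S = T := by
  rw [← mk_rep S, ← mk_rep T, mk_eq_mk]
  exact h

theorem rep_inv_comp_rep (T : AutMP μ) : T⁻¹.rep ∘ T.rep =ᵐ[μ] id := by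
  have h := rep_mul T⁻¹ T
  rw [inv_mul_cancel] at h
  exact h.symm.trans rep_one

theorem comp_ae_eq_id_of_comp_rep [MeasurableEq X] {Y : Type*} [MeasurableSpace Y] {P : Measure Y}
    {π : Y → X} (hπ : MeasurePreserving π P μ) {T : AutMP P} {g g' : X → X} (hg : Measurable g)
    (hg' : Measurable g') (h : π ∘ T.rep =ᵐ[P] g ∘ π) (h' : π ∘ T⁻¹.rep =ᵐ[P] g' ∘ π) :
    g' ∘ g =ᵐ[μ] id := by
  refine ae_eq_of_comp_ae_eq hπ (hg'.comp hg) measurable_id ?_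
  calc g' ∘ g ∘ π
    _ =ᵐ[P] g' ∘ π ∘ T.rep := h.symm.fun_comp g'
    _ =ᵐ[P] π ∘ T⁻¹.rep ∘ T.rep :=
      (T.measurePreserving_rep.quasiMeasurePreserving.ae_eq_comp h').symm
    _ =ᵐ[P] id ∘ π := T.rep_inv_comp_rep.fun_comp π

theorem exists_rep_ae_eq {f g : X → X} (hf : MeasurePreserving f μ μ)
    (hg : Measure.QuasiMeasurePreserving g μ μ) (hgf : g ∘ f =ᵐ[μ] id) (hfg : f ∘ g =ᵐ[μ] id) :
    ∃ T : AutMP μ, T.rep =ᵐ[μ] f := by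
  obtain ⟨e, he⟩ :=
    exists_measurableEquiv_ae_eq hf.quasiMeasurePreserving hg hgf hfg
  have he_mp : MeasurePreserving e μ μ := ⟨e.measurable, (Measure.map_congr he).trans hf.map_eq⟩
  exact ⟨mk e he_mp, (rep_mk e he_mp).trans he⟩

theorem edist_preimage (T : AutMP μ) (A B : MeasuredSets μ) :
    edist (T.preimage A) (T.preimage B) = edist A B := by
  rw [MeasuredSets.edist_def, MeasuredSets.edist_def]
  exact T.measurePreserving_rep.measure_preimage (A.2.symmDiff B.2).nullMeasurableSet

theorem continuous_preimage (A : MeasuredSets μ) :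
    Continuous fun T : AutMP μ => T.preimage A :=
  continuous_iInf_dom (i := A) continuous_induced_dom

end Basic

section Invariants

variable {X : Type*} [MeasurableSpace X] {μ : Measure X} {Λ : Type*} [Group Λ]
  {ρ : Λ →* AutMP μ}

/-- The σ-algebra of measurable sets that are invariant, up to null sets, under a measure
preserving action. -/
abbrev invariants (ρ : Λ →* AutMP μ) : MeasurableSpace X where
  MeasurableSet' s := MeasurableSet s ∧ ∀ l, (ρ l).rep ⁻¹' s =ᵐ[μ] s
  measurableSet_empty := ⟨.empty, fun _ => .rfl⟩
  measurableSet_compl _ hs := ⟨hs.1.compl, fun l => (hs.2 l).compl⟩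
  measurableSet_iUnion s hs := by
    refine ⟨.iUnion fun n => (hs n).1, fun l => ?_⟩
    rw [Set.preimage_iUnion]
    exact Filter.EventuallyEq.countable_iUnion fun n => (hs n).2 l

theorem comap_le_invariants {Y : Type*} [mY : MeasurableSpace Y] {f : X → Y} (hf : Measurable f)
    (h : ∀ l, f ∘ (ρ l).rep =ᵐ[μ] f) : mY.comap f ≤ invariants ρ := by
  rintro _ ⟨B, hB, rfl⟩
  exact ⟨hf hB, fun l => (h l).preimage B⟩

theorem IsErgodicAction.eq_smul [IsProbabilityMeasure μ] (hρ : IsErgodicAction ρ) {ν : Measure X}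
    [IsFiniteMeasure ν] (hν : ν ≪ μ) (h : ∀ l, MeasurePreserving (ρ l).rep ν ν) :
    ν = ν Set.univ • μ := by
  have hconst : ∃ c, ν.rnDeriv μ =ᵐ[μ] Function.const X c := by
    refine Filter.exists_eventuallyEq_const_of_forall_separating MeasurableSet fun U hU => ?_
    have hinv (l : Λ) : (ρ l).rep ⁻¹' (ν.rnDeriv μ ⁻¹' U) =ᵐ[μ] ν.rnDeriv μ ⁻¹' U :=
      ((h l).rnDeriv_comp_aeEq (ρ l).measurePreserving_rep).preimage U
    exact (hρ _ (Measure.measurable_rnDeriv ν μ hU) hinv).symm.imp id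
      measure_eq_zero_iff_ae_notMem.1
  obtain ⟨c, hc⟩ := hconst
  have hν_eq : ν = c • μ := by
    rw [← Measure.withDensity_rnDeriv_eq ν μ hν, withDensity_congr_ae hc]
    exact withDensity_const c
  have hc_eq : ν Set.univ = c := by rw [hν_eq]; simp
  rwa [hc_eq]

theorem IsErgodicAction.map_restrict [IsProbabilityMeasure μ] (hρ : IsErgodicAction ρ)
    {Y : Type*} [MeasurableSpace Y] {P : Measure Y} [IsFiniteMeasure P] {σ : Λ →* AutMP P}
    {π : Y → X} (hπ : MeasurePreserving π P μ) (hσ : ∀ l, π ∘ (σ l).rep =ᵐ[P] (ρ l).rep ∘ π)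
    {s : Set Y} (hs : MeasurableSet[invariants σ] s) :
    (P.restrict s).map π = P s • μ := by
  obtain ⟨hs_meas, hs_inv⟩ := hs
  have hac : (P.restrict s).map π ≪ μ := by
    rw [← hπ.map_eq]
    exact (Measure.absolutelyContinuous_of_le Measure.restrict_le_self).map hπ.measurable
  have hinv (l : Λ) :
      MeasurePreserving (ρ l).rep ((P.restrict s).map π) ((P.restrict s).map π) := by
    have hσs : MeasurePreserving (σ l).rep (P.restrict s) (P.restrict s) := by
      have := (σ l).measurePreserving_rep.restrict_preimage hs_meas
      rwa [Measure.restrict_congr_set (hs_inv l)] at this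
    refine ⟨(ρ l).rep.measurable, ?_⟩
    calc ((P.restrict s).map π).map (ρ l).rep
      _ = (P.restrict s).map ((ρ l).rep ∘ π) := Measure.map_map (ρ l).rep.measurable hπ.measurable
      _ = (P.restrict s).map (π ∘ (σ l).rep) := Measure.map_congr (ae_restrict_of_ae (hσ l).symm)
      _ = (P.restrict s).map π := by
        rw [← Measure.map_map hπ.measurable (σ l).rep.measurable, hσs.map_eq]
  rw [hρ.eq_smul hac hinv, Measure.map_apply hπ.measurable .univ]
  simp

theorem IsErgodicAction.indep_invariants_comap [IsProbabilityMeasure μ] (hρ : IsErgodicAction ρ)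
    {Y : Type*} [MeasurableSpace Y] {P : Measure Y} [IsFiniteMeasure P] {σ : Λ →* AutMP P}
    {π : Y → X} (hπ : MeasurePreserving π P μ) (hσ : ∀ l, π ∘ (σ l).rep =ᵐ[P] (ρ l).rep ∘ π) :
    Indep (invariants σ) (MeasurableSpace.comap π ‹_›) P := by
  rw [Indep_iff]
  rintro s _ hs ⟨B, hB, rfl⟩
  have h := congrArg (· B) (hρ.map_restrict hπ hσ hs)
  simp only [Measure.map_apply hπ.measurable hB, Measure.restrict_apply (hπ.measurable hB),
    Measure.smul_apply, smul_eq_mul] at h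
  rw [Set.inter_comm, h, hπ.measure_preimage hB.nullMeasurableSet]

end Invariants

section Product

variable {I : Type*} [Countable I] {X : I → Type*} [∀ i, MeasurableSpace (X i)]
  (μ : ∀ i, Measure (X i)) [∀ i, IsProbabilityMeasure (μ i)]

theorem prodHom_rep (T : ∀ i, AutMP (μ i)) :
    ∀ᵐ x ∂(Measure.infinitePi μ), ∀ i, (prodHom μ T).rep x i = (T i).rep (x i) := by
  have h := rep_mk (MeasurableEquiv.piCongrRight fun i => (T i).rep)
    (measurePreserving_piCongrRight μ _ fun i => (T i).measurePreserving_rep)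
  filter_upwards [h] with x hx i using congrFun hx i

theorem coordHom_apply [DecidableEq I] (i : I) (S : AutMP (μ i)) :
    coordHom μ i S = prodHom μ (Pi.mulSingle i S) := by
  simp only [coordHom, MonoidHom.comp_apply, MonoidHom.mulSingle_apply]
  congr!

theorem eval_comp_coordHom_rep_self (i : I) (S : AutMP (μ i)) :
    Function.eval i ∘ (coordHom μ i S).rep =ᵐ[Measure.infinitePi μ] S.rep ∘ Function.eval i := by
  classical
  filter_upwards [prodHom_rep μ (Pi.mulSingle i S)] with x hx
  rw [coordHom_apply, Function.comp_apply, Function.eval, hx i, Pi.mulSingle_eq_same]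
  rfl

theorem eval_comp_coordHom_rep_of_ne {i j : I} (hij : i ≠ j) (S : AutMP (μ j)) :
    Function.eval i ∘ (coordHom μ j S).rep =ᵐ[Measure.infinitePi μ] Function.eval i := by
  classical
  filter_upwards [prodHom_rep μ (Pi.mulSingle j S),
    (measurePreserving_eval_infinitePi μ i).quasiMeasurePreserving.ae rep_one] with x hx hx_one
  rw [coordHom_apply, Function.comp_apply, Function.eval, hx i, Pi.mulSingle_eq_of_ne hij]
  exact hx_one

theorem prodHom_injective [∀ i, MeasurableEq (X i)] :
    Function.Injective (prodHom μ) := by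
  intro S T h
  funext i
  refine ext_rep (ae_eq_of_comp_ae_eq (measurePreserving_eval_infinitePi μ i)
    (S i).rep.measurable (T i).rep.measurable ?_)
  filter_upwards [prodHom_rep μ S, prodHom_rep μ T] with x hS hT
  rw [Function.comp_apply, Function.comp_apply, Function.eval, ← hS i, ← hT i, h]

end Product

section CoordInvariants

variable {I : Type*} [Countable I] {X : I → Type*} [∀ i, MeasurableSpace (X i)]
  {μ : ∀ i, Measure (X i)} [∀ i, IsProbabilityMeasure (μ i)]
  {Λ : I → Type*} [∀ i, Group (Λ i)] {ρ : ∀ i, Λ i →* AutMP (μ i)}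

/-- The σ-algebra of measurable subsets of the product that are invariant, up to null sets, under
`Λ i` acting in the `i`-th coordinate, for all `i ∈ J`. -/
noncomputable abbrev coordInvariants (ρ : ∀ i, Λ i →* AutMP (μ i)) (J : Set I) :
    MeasurableSpace (∀ i, X i) :=
  MeasurableSpace.pi ⊓ ⨅ i ∈ J, invariants ((coordHom μ i).comp (ρ i))

theorem measurableSet_coordInvariants {J : Set I} {s : Set (∀ i, X i)} :
    MeasurableSet[coordInvariants ρ J] s ↔ MeasurableSet s ∧
      ∀ i ∈ J, ∀ l, (coordHom μ i (ρ i l)).rep ⁻¹' s =ᵐ[Measure.infinitePi μ] s := by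
  simp only [MeasurableSpace.measurableSet_inf, MeasurableSpace.measurableSet_iInf]
  exact ⟨fun h => ⟨h.1, fun i hi => (h.2 i hi).2⟩, fun h => ⟨h.1, fun i hi => ⟨h.1, h.2 i hi⟩⟩⟩

theorem comap_eval_le_invariants {i j : I} (hij : i ≠ j) :
    MeasurableSpace.comap (Function.eval i) inferInstance ≤
      invariants ((coordHom μ j).comp (ρ j)) :=
  comap_le_invariants (measurable_pi_apply i) fun l => eval_comp_coordHom_rep_of_ne μ hij (ρ j l)

theorem cylinderEvents_compl_le_coordInvariants (J : Set I) :
    cylinderEvents Jᶜ ≤ coordInvariants ρ J :=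
  le_inf cylinderEvents_le_pi <| iSup₂_le fun _ hi => le_iInf₂ fun _ hj =>
    comap_eval_le_invariants (ne_of_mem_of_not_mem hj hi).symm

theorem indep_coordInvariants_cylinderEvents (hρ : ∀ i, IsErgodicAction (ρ i)) (J : Set I) :
    Indep (coordInvariants ρ J) (cylinderEvents J) (Measure.infinitePi μ) :=
  indep_biSup_of_indep inf_le_left (fun i _ => (measurable_pi_apply i).comap_le)
    (fun i hi => inf_le_right.trans (iInf₂_le i hi))
    (fun _ _ _ _ hij => comap_eval_le_invariants hij) fun i _ =>
    (hρ i).indep_invariants_comap (measurePreserving_eval_infinitePi μ i)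
      fun l => eval_comp_coordHom_rep_self μ i (ρ i l)

theorem coordInvariants_le_eventuallyMeasurableSpace (hρ : ∀ i, IsErgodicAction (ρ i))
    (J : Set I) :
    coordInvariants ρ J ≤
      eventuallyMeasurableSpace (cylinderEvents Jᶜ) (ae (Measure.infinitePi μ)) := by
  refine le_eventuallyMeasurableSpace_of_indep (cylinderEvents_compl_le_coordInvariants J)
    inf_le_left ?_ (indep_coordInvariants_cylinderEvents hρ J)
  rw [← cylinderEvents_univ, ← Set.compl_union_self J]
  exact iSup_union.symm

theorem coordHom_mem_coordSubgroup (i : I) (l : Λ i) :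
    coordHom μ i (ρ i l) ∈ coordSubgroup μ ρ :=
  Subgroup.mem_iSup_of_mem i ⟨l, rfl⟩

theorem isErgodicAction_coordSubgroup (hρ : ∀ i, IsErgodicAction (ρ i)) :
    IsErgodicAction (coordSubgroup μ ρ).subtype := by
  intro s hs hs_inv
  have hs_coord : MeasurableSet[coordInvariants ρ Set.univ] s :=
    measurableSet_coordInvariants.2
      ⟨hs, fun i _ l => hs_inv ⟨_, coordHom_mem_coordSubgroup i l⟩⟩
  obtain ⟨t, ht, hst⟩ := coordInvariants_le_eventuallyMeasurableSpace hρ _ _ hs_coord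
  have hbot : cylinderEvents (X := X) Set.univᶜ = ⊥ := by simp [cylinderEvents]
  obtain rfl | rfl := MeasurableSpace.measurableSet_bot_iff.1 (hbot ▸ ht)
  · exact .inl (ae_eq_empty.1 hst)
  · exact .inr (ae_eq_univ.1 hst)

end CoordInvariants

section Centralizer

variable {I : Type*} [Countable I] {X : I → Type*} [∀ i, MeasurableSpace (X i)]
  {μ : ∀ i, Measure (X i)} [∀ i, IsProbabilityMeasure (μ i)]
  {Λ : I → Type*} [∀ i, Group (Λ i)] {ρ : ∀ i, Λ i →* AutMP (μ i)}

theorem coordSubgroup_eq_closure :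
    coordSubgroup μ ρ = Subgroup.closure (⋃ i, Set.range fun l => coordHom μ i (ρ i l)) :=
  Subgroup.iSup_eq_closure _

theorem countable_coordSubgroup [∀ i, Countable (Λ i)] : Countable (coordSubgroup μ ρ) := by
  rw [coordSubgroup_eq_closure]
  exact countable_subgroup_closure (Set.countable_iUnion fun i => Set.countable_range _)

theorem mem_centralizer_coordSubgroup {T : AutMP (Measure.infinitePi μ)} :
    T ∈ Subgroup.centralizer (coordSubgroup μ ρ : Set (AutMP (Measure.infinitePi μ))) ↔
      ∀ i l, Commute (coordHom μ i (ρ i l)) T := by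
  rw [coordSubgroup_eq_closure, Subgroup.centralizer_closure, Subgroup.mem_centralizer_iff]
  simp only [Set.mem_iUnion, Set.mem_range]
  exact ⟨fun h i l => h _ ⟨i, l, rfl⟩, by rintro h _ ⟨i, l, rfl⟩; exact h i l⟩

theorem prodHom_mem_centralizer_coordSubgroup_iff [∀ i, MeasurableEq (X i)]
    {S : ∀ i, AutMP (μ i)} :
    prodHom μ S ∈ Subgroup.centralizer (coordSubgroup μ ρ : Set (AutMP (Measure.infinitePi μ))) ↔
      ∀ i, S i ∈ Subgroup.centralizer (Set.range (ρ i)) := by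
  classical
  rw [mem_centralizer_coordSubgroup]
  simp only [Subgroup.mem_centralizer_iff, Set.forall_mem_range]
  refine forall₂_congr fun i l => ?_
  rw [coordHom_apply, Commute, SemiconjBy, ← map_mul, ← map_mul, (prodHom_injective μ).eq_iff]
  refine ⟨fun h => by simpa using congrFun h i, fun h => funext fun j => ?_⟩
  obtain rfl | hj := eq_or_ne j i
  · simpa using h
  · simp [Pi.mulSingle_eq_of_ne hj]

theorem comap_eval_comp_rep_le_coordInvariants {T : AutMP (Measure.infinitePi μ)}
    (hT : ∀ i l, Commute (coordHom μ i (ρ i l)) T) (i : I) :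
    MeasurableSpace.comap (Function.eval i ∘ T.rep) inferInstance ≤ coordInvariants ρ {i}ᶜ := by
  have hmeas : Measurable (Function.eval i ∘ T.rep) := (measurable_pi_apply i).comp T.rep.measurable
  refine le_inf hmeas.comap_le (le_iInf₂ fun j hj => comap_le_invariants hmeas fun l => ?_)
  set S := coordHom μ j (ρ j l)
  have hTS : T.rep ∘ S.rep =ᵐ[Measure.infinitePi μ] S.rep ∘ T.rep :=
    (rep_mul T S).symm.trans ((hT j l).eq ▸ rep_mul S T)
  calc Function.eval i ∘ T.rep ∘ S.rep
    _ =ᵐ[Measure.infinitePi μ] (Function.eval i ∘ S.rep) ∘ T.rep := hTS.fun_comp (Function.eval i)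
    _ =ᵐ[Measure.infinitePi μ] Function.eval i ∘ T.rep :=
      T.measurePreserving_rep.quasiMeasurePreserving.ae_eq_comp
        (eval_comp_coordHom_rep_of_ne μ (Ne.symm hj) (ρ j l))

theorem exists_measurePreserving_of_commute [∀ i, StandardBorelSpace (X i)]
    (hρ : ∀ i, IsErgodicAction (ρ i)) {T : AutMP (Measure.infinitePi μ)}
    (hT : ∀ i l, Commute (coordHom μ i (ρ i l)) T) (i : I) :
    ∃ g : X i → X i, MeasurePreserving g (μ i) (μ i) ∧
      Function.eval i ∘ T.rep =ᵐ[Measure.infinitePi μ] g ∘ Function.eval i := by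
  have : Nonempty (X i) := nonempty_of_isProbabilityMeasure (μ i)
  have heval := measurePreserving_eval_infinitePi μ i
  have hsingle : cylinderEvents (X := X) {i}ᶜᶜ =
      MeasurableSpace.comap (Function.eval i) inferInstance := by
    rw [compl_compl, cylinderEvents, iSup_singleton]
  have hle := (comap_eval_comp_rep_le_coordInvariants hT i).trans
    (coordInvariants_le_eventuallyMeasurableSpace hρ {i}ᶜ)
  rw [hsingle] at hle
  obtain ⟨g, hg, hgT⟩ := exists_measurable_eventuallyEq_comp_of_eventuallyMeasurable
    (measurable_iff_comap_le.2 hle)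
  refine ⟨g, ⟨hg, ?_⟩, hgT⟩
  calc (μ i).map g
    _ = (Measure.infinitePi μ).map (g ∘ Function.eval i) := by
      rw [← Measure.map_map hg heval.measurable, heval.map_eq]
    _ = (Measure.infinitePi μ).map (Function.eval i ∘ T.rep) := (Measure.map_congr hgT).symm
    _ = μ i := (heval.comp T.measurePreserving_rep).map_eq

theorem exists_prodHom_eq_of_mem_centralizer [∀ i, StandardBorelSpace (X i)]
    (hρ : ∀ i, IsErgodicAction (ρ i)) {T : AutMP (Measure.infinitePi μ)}
    (hT : T ∈ Subgroup.centralizer (coordSubgroup μ ρ : Set (AutMP (Measure.infinitePi μ)))) :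
    ∃ S : ∀ i, AutMP (μ i), prodHom μ S = T := by
  choose g hg hgT using
    exists_measurePreserving_of_commute hρ (mem_centralizer_coordSubgroup.1 hT)
  choose g' hg' hgT' using
    exists_measurePreserving_of_commute hρ (mem_centralizer_coordSubgroup.1 (inv_mem hT))
  choose S hS using fun i => exists_rep_ae_eq (hg i) (hg' i).quasiMeasurePreserving
    (comp_ae_eq_id_of_comp_rep (measurePreserving_eval_infinitePi μ i) (hg i).measurable
      (hg' i).measurable (hgT i) (hgT' i))
    (comp_ae_eq_id_of_comp_rep (measurePreserving_eval_infinitePi μ i) (hg' i).measurable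
      (hg i).measurable (hgT' i) ((inv_inv T).symm ▸ hgT i))
  refine ⟨S, ext_rep ?_⟩
  filter_upwards [prodHom_rep μ S, ae_all_iff.2 hgT, ae_all_iff.2 fun i =>
    (measurePreserving_eval_infinitePi μ i).quasiMeasurePreserving.ae (hS i)] with x hx hT hS
  funext i
  rw [hx i, hS i]
  exact (hT i).symm

end Centralizer

section Topology

variable {X : Type*} {m : MeasurableSpace X} {μ : Measure X} {Z : Type*} [TopologicalSpace Z]
  {φ : Z → AutMP μ}

theorem continuous_preimage_compl {A : Set X} {hA : MeasurableSet A}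
    (h : Continuous fun z => (φ z).preimage ⟨A, hA⟩) :
    Continuous fun z => (φ z).preimage ⟨Aᶜ, hA.compl⟩ := by
  refine continuous_of_edist_eq h fun x y => ?_
  rw [MeasuredSets.edist_def, MeasuredSets.edist_def]
  exact congrArg μ (compl_symmDiff_compl _ _)

theorem continuous_preimage_union {A B : Set X} {hA : MeasurableSet A} {hB : MeasurableSet B}
    (h : Continuous fun z => (φ z).preimage ⟨A, hA⟩)
    (h' : Continuous fun z => (φ z).preimage ⟨B, hB⟩) :
    Continuous fun z => (φ z).preimage ⟨A ∪ B, hA.union hB⟩ := by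
  refine continuous_iff_continuousAt.2 fun x => EMetric.tendsto_nhds.2 fun ε hε => ?_
  filter_upwards [EMetric.tendsto_nhds.1 (h.tendsto x) _ (ENNReal.half_pos hε.ne'),
    EMetric.tendsto_nhds.1 (h'.tendsto x) _ (ENNReal.half_pos hε.ne')] with y hy hy'
  refine lt_of_le_of_lt ?_ ((ENNReal.add_lt_add hy hy').trans_eq (ENNReal.add_halves ε))
  simp only [MeasuredSets.edist_def]
  exact (measure_mono Set.union_symmDiff_union_subset).trans (measure_union_le _ _)

theorem continuous_preimage_iUnion_of_monotone [IsFiniteMeasure μ] {A : ℕ → Set X}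
    (hA_mono : Monotone A) {hA : ∀ n, MeasurableSet (A n)}
    (h : ∀ n, Continuous fun z => (φ z).preimage ⟨A n, hA n⟩) :
    Continuous fun z => (φ z).preimage ⟨⋃ n, A n, .iUnion hA⟩ := by
  have hlim : Tendsto (fun n => μ ((⋃ n, A n) \ A n)) atTop (nhds 0) := by
    have hempty : ⋂ n, (⋃ n, A n) \ A n = ∅ := by rw [← Set.sdiff_iUnion, Set.sdiff_self]
    rw [← measure_empty (μ := μ), ← hempty]
    exact tendsto_measure_iInter_atTop
      (fun n => ((MeasurableSet.iUnion hA).diff (hA n)).nullMeasurableSet)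
      (fun _ _ hmn => Set.sdiff_subset_sdiff_right (hA_mono hmn)) ⟨0, measure_ne_top μ _⟩
  refine TendstoUniformly.continuous (F := fun n z => (φ z).preimage ⟨A n, hA n⟩) (p := atTop)
    (EMetric.tendstoUniformly_iff.2 fun ε hε => ?_) (.of_forall h)
  filter_upwards [hlim.eventually_lt_const hε] with n hn z
  refine ((edist_preimage _ _ _).trans ?_).trans_lt hn
  exact congrArg μ (symmDiff_of_ge (Set.subset_iUnion A n))

theorem continuous_preimage_iUnion [IsFiniteMeasure μ] {A : ℕ → Set X}
    {hA : ∀ n, MeasurableSet (A n)} (h : ∀ n, Continuous fun z => (φ z).preimage ⟨A n, hA n⟩) :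
    Continuous fun z => (φ z).preimage ⟨⋃ n, A n, .iUnion hA⟩ := by
  have hacc_meas (n : ℕ) : MeasurableSet (Set.accumulate A n) :=
    .biUnion (Set.to_countable _) fun k _ => hA k
  have hacc (n : ℕ) : Continuous fun z => (φ z).preimage ⟨Set.accumulate A n, hacc_meas n⟩ := by
    induction n with
    | zero => simpa only [Set.accumulate_zero_nat] using h 0
    | succ n ih => simpa only [Set.accumulate_succ] using continuous_preimage_union ih (h (n + 1))
  simpa only [Set.iUnion_accumulate] using
    continuous_preimage_iUnion_of_monotone Set.monotone_accumulate hacc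

theorem continuous_of_generateFrom [IsFiniteMeasure μ] {C : Set (Set X)}
    (hC : m ≤ MeasurableSpace.generateFrom C)
    (h : ∀ A ∈ C, ∃ hA : MeasurableSet A, Continuous fun z => (φ z).preimage ⟨A, hA⟩) :
    Continuous φ := by
  let m' : MeasurableSpace X :=
    { MeasurableSet' := fun A => ∃ hA : MeasurableSet A, Continuous fun z => (φ z).preimage ⟨A, hA⟩
      measurableSet_empty :=
        ⟨.empty, continuous_const (y := show MeasuredSets μ from ⟨∅, .empty⟩)⟩
      measurableSet_compl := fun _ ⟨hA, h⟩ => ⟨hA.compl, continuous_preimage_compl h⟩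
      measurableSet_iUnion := fun _ hA =>
        ⟨.iUnion fun n => (hA n).1, continuous_preimage_iUnion fun n => (hA n).2⟩ }
  have hle : m ≤ m' := hC.trans (MeasurableSpace.generateFrom_le h)
  exact continuous_iInf_rng.2 fun A => continuous_induced_rng.2 (hle A.1 A.2).2

end Topology

section ProductTopology

variable {I : Type*} [Countable I] {X : I → Type*} [∀ i, MeasurableSpace (X i)]
  (μ : ∀ i, Measure (X i)) [∀ i, IsProbabilityMeasure (μ i)]

theorem edist_prodHom_preimage_eval_preimage (S T : ∀ i, AutMP (μ i)) (i : I) {B : Set (X i)}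
    (hB : MeasurableSet B) (hB' : MeasurableSet (Function.eval i ⁻¹' B)) :
    edist ((prodHom μ S).preimage ⟨Function.eval i ⁻¹' B, hB'⟩)
      ((prodHom μ T).preimage ⟨Function.eval i ⁻¹' B, hB'⟩) =
      edist ((S i).preimage ⟨B, hB⟩) ((T i).preimage ⟨B, hB⟩) := by
  have hpre (S : ∀ i, AutMP (μ i)) : (prodHom μ S).rep ⁻¹' (Function.eval i ⁻¹' B)
      =ᵐ[Measure.infinitePi μ] Function.eval i ⁻¹' ((S i).rep ⁻¹' B) := by
    have h : Function.eval i ∘ (prodHom μ S).rep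
        =ᵐ[Measure.infinitePi μ] (S i).rep ∘ Function.eval i :=
      (prodHom_rep μ S).mono fun _ hx => hx i
    exact h.preimage B
  rw [MeasuredSets.edist_def, MeasuredSets.edist_def]
  refine (measure_congr ((hpre S).symmDiff (hpre T))).trans ?_
  exact (measurePreserving_eval_infinitePi μ i).measure_preimage
    (((S i).rep.measurable hB).symmDiff ((T i).rep.measurable hB)).nullMeasurableSet

theorem continuous_prodHom : Continuous (prodHom μ) := by
  refine continuous_of_generateFrom
    (MeasurableSpace.generateFrom_iUnion_measurableSet
      fun i => MeasurableSpace.comap (Function.eval i) inferInstance).ge fun A hA => ?_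
  obtain ⟨i, B, hB, rfl⟩ := Set.mem_iUnion.1 hA
  have hB' := measurable_pi_apply i hB
  exact ⟨hB', continuous_of_edist_eq
    ((continuous_preimage (μ := μ i) ⟨B, hB⟩).comp (continuous_apply i))
    fun S T => edist_prodHom_preimage_eval_preimage μ S T i hB hB'⟩

theorem isInducing_prodHom : Topology.IsInducing (prodHom μ) := by
  refine ⟨le_antisymm (continuous_prodHom μ).le_induced (le_iInf fun i => ?_)⟩
  let := TopologicalSpace.induced (prodHom μ) inferInstance
  refine continuous_iff_le_induced.1 (continuous_iInf_rng.2 fun B => continuous_induced_rng.2 ?_)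
  have hB := measurable_pi_apply i B.2
  exact continuous_of_edist_eq
    ((continuous_preimage (μ := Measure.infinitePi μ) ⟨Function.eval i ⁻¹' B.1, hB⟩).comp
      continuous_induced_dom)
    fun S T => (edist_prodHom_preimage_eval_preimage μ S T i B.2 hB).symm

end ProductTopology

section CentralizerEquiv

variable {I : Type*} [Countable I] {X : I → Type*} [∀ i, MeasurableSpace (X i)]
  [∀ i, StandardBorelSpace (X i)] {μ : ∀ i, Measure (X i)} [∀ i, IsProbabilityMeasure (μ i)]
  {Λ : I → Type*} [∀ i, Group (Λ i)] {ρ : ∀ i, Λ i →* AutMP (μ i)}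

/-- The restriction of `prodHom` to the centralizers of the given actions. -/
noncomputable def centralizerProdHom (ρ : ∀ i, Λ i →* AutMP (μ i)) :
    (∀ i, Subgroup.centralizer (Set.range (ρ i))) →*
      Subgroup.centralizer (coordSubgroup μ ρ : Set (AutMP (Measure.infinitePi μ))) :=
  ((prodHom μ).comp (MonoidHom.piMap fun _ => Subgroup.subtype _)).codRestrict _ fun T =>
    prodHom_mem_centralizer_coordSubgroup_iff.2 fun i => (T i).2

theorem isInducing_centralizerProdHom : Topology.IsInducing (centralizerProdHom ρ) :=
  (Topology.IsInducing.of_comp_iff .subtypeVal).1 <|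
    (isInducing_prodHom μ).comp (.piMap fun _ => .subtypeVal)

theorem bijective_centralizerProdHom (hρ : ∀ i, IsErgodicAction (ρ i)) :
    Function.Bijective (centralizerProdHom ρ) := by
  refine ⟨fun S T h => funext fun i => ?_, fun ⟨T, hT⟩ => ?_⟩
  · exact Subtype.ext (congrFun (prodHom_injective μ (congrArg Subtype.val h)) i)
  · obtain ⟨S, rfl⟩ := exists_prodHom_eq_of_mem_centralizer hρ hT
    exact ⟨fun i => ⟨S i, prodHom_mem_centralizer_coordSubgroup_iff.1 hT i⟩, rfl⟩

/-- The product of the centralizers of ergodic actions, identified through `prodHom` with the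
centralizer of the group generated by these actions in the coordinates. -/
noncomputable def centralizerProdEquiv (hρ : ∀ i, IsErgodicAction (ρ i)) :
    (∀ i, Subgroup.centralizer (Set.range (ρ i))) ≃ₜ*
      Subgroup.centralizer (coordSubgroup μ ρ : Set (AutMP (Measure.infinitePi μ))) :=
  { MulEquiv.ofBijective _ (bijective_centralizerProdHom hρ),
    (Equiv.ofBijective _ (bijective_centralizerProdHom hρ)).toHomeomorphOfIsInducing
      isInducing_centralizerProdHom with }

end CentralizerEquiv

end AutMP

theorem IsCentralizerGroup.of_subgroup {G : Type*} [Group G] [TopologicalSpace G]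
    [IsTopologicalGroup G] [PolishSpace G] {X : Type} [MeasurableSpace X] [StandardBorelSpace X]
    {μ : Measure X} [IsProbabilityMeasure μ] {Γ : Subgroup (AutMP μ)} [Countable Γ]
    (hΓ : AutMP.IsErgodicAction Γ.subtype)
    (e : G ≃ₜ* Subgroup.centralizer (Γ : Set (AutMP μ))) : IsCentralizerGroup G := by
  refine ⟨inferInstance, inferInstance, X, inferInstance, inferInstance, μ, inferInstance,
    Γ, inferInstance, inferInstance, Γ.subtype, hΓ, ?_⟩
  rw [show Set.range Γ.subtype = Γ from Subtype.range_coe]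
  exact ⟨e⟩

theorem IsCentralizerGroup.pi {I : Type*} [Countable I] {G : I → Type*} [∀ i, Group (G i)]
    [∀ i, TopologicalSpace (G i)] (h : ∀ i, IsCentralizerGroup (G i)) :
    IsCentralizerGroup (∀ i, G i) := by
  have : ∀ i, IsTopologicalGroup (G i) := fun i => (h i).1
  have : ∀ i, PolishSpace (G i) := fun i => (h i).2.1
  choose X _ _ μ _ Λ _ _ ρ hρ e using fun i => (h i).2.2
  -- `IsCentralizerGroup` asks for a probability space in `Type`, so `I` is moved there first.
  let r : Shrink.{0} I ≃ I := (equivShrink.{0} I).symm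
  have : Countable (Shrink.{0} I) := r.injective.countable
  have : Countable (AutMP.coordSubgroup (fun j => μ (r j)) fun j => ρ (r j)) :=
    AutMP.countable_coordSubgroup
  exact .of_subgroup (AutMP.isErgodicAction_coordSubgroup fun j => hρ (r j)) <|
    (piReindexContinuousMulEquiv G r).trans <|
      (piCongrRightContinuousMulEquiv fun j => (e (r j)).some).trans <|
        AutMP.centralizerProdEquiv fun j => hρ (r j)

/-- A countable product of centralizer groups is a centralizer group. Moreover, given realizations
of the `G i` as centralizers of ergodic actions `Λ i ↷ (X i, μ i)`, the product is the centralizer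
of the countable ergodic group generated by the `Λ i` acting in their own coordinates of the
product space, with `g` acting as the product of the automorphisms given by the `g i`. -/
theorem mainTheorem6 {I : Type*} [Countable I] (G : I → Type*)
    [∀ i, Group (G i)] [∀ i, TopologicalSpace (G i)] :
    ((∀ i, IsCentralizerGroup (G i)) → IsCentralizerGroup (∀ i, G i)) ∧
    (∀ (X : I → Type*) [∀ i, MeasurableSpace (X i)] [∀ i, StandardBorelSpace (X i)]
      (μ : ∀ i, Measure (X i)) [∀ i, IsProbabilityMeasure (μ i)]
      (Λ : I → Type*) [∀ i, Group (Λ i)] [∀ i, Countable (Λ i)]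
      (ρ : ∀ i, Λ i →* AutMP (μ i)) (_ : ∀ i, AutMP.IsErgodicAction (ρ i))
      (e : ∀ i, G i ≃ₜ* Subgroup.centralizer (Set.range (ρ i))),
      StandardBorelSpace (∀ i, X i) ∧
      Countable (AutMP.coordSubgroup μ ρ) ∧
      AutMP.IsErgodicAction (AutMP.coordSubgroup μ ρ).subtype ∧
      ∃ E : (∀ i, G i) ≃ₜ*
          Subgroup.centralizer (AutMP.coordSubgroup μ ρ : Set (AutMP (Measure.infinitePi μ))),
        ∀ g : ∀ i, G i,
          (E g : AutMP (Measure.infinitePi μ)) =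
            AutMP.prodHom μ (fun i => (e i (g i) : AutMP (μ i)))) := by
  exact ⟨.pi, fun X _ _ μ _ Λ _ _ ρ hρ e =>
    ⟨inferInstance, AutMP.countable_coordSubgroup, AutMP.isErgodicAction_coordSubgroup hρ,
      (piCongrRightContinuousMulEquiv e).trans (AutMP.centralizerProdEquiv hρ), fun _ => rfl⟩⟩
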